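/- Let $\mathcal M=(Q,\mathsf A,\delta)$ be a Markov decision process with a finite set $Q$ of $n=|Q|$ states, a finite nonempty set $\mathsf A$ of actions, and a probabilistic transition function $\delta$ that assigns to each $(q,a)\in Q\times\mathsf A$ a probability distribution $\delta(q,a)$ over $Q$. Let $\alpha$ be the smallest positive value among the transition probabilities $\delta(q,a)(q')$, let $T\subseteq Q$, let $d_0$ be an initial probability distribution over $Q$, and let $\alpha_0$ be the smallest positive value of $d_0$. A (randomized) strategy $\sigma$ maps each finite sequence $q_0a_0q_1a_1\dots q_k$ of alternating states and actions to a probability distribution over $\mathsf A$; for $i\ge 0$ let $\mathcal M^\sigma_i(q)$ be the probability, from $d_0$ and under $\sigma$, of being in state $q$ after exactly $i$ steps, and let $\mathcal M^\sigma_i(T)=\sum_{q\in T}\mathcal M^\sigma_i(q)$. The distribution $d_0$ is almost-sure weakly synchronizing in $T$ if there is a strategy $\sigma$ such that for all $\epsilon>0$ we have $\mathcal M^\sigma_i(T)\ge 1-\epsilon$ for infinitely many $i$. Let $$\epsilon_w=\alpha_0\cdot\frac{\alpha^{(n+2)\cdot 4^n}}{n^{2^n+1}}\qquad\text{and}\qquad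 N_w=2^n .$$ If $d_0$ is not almost-sure weakly synchronizing in $T$, then for all strategies $\sigma$, at most $N_w$ distributions in the sequence $(\mathcal M^\sigma_i)_{i\ge 0}$ are strictly $(1-\epsilon_w)$-synchronized in $T$, that is, $\mathcal M^\sigma_i(T)>1-\epsilon_w$ for at most $N_w$ values of $i$. -/

import Mathlib

/-- Probability distributions over a finite set `X`: functions `d : X → ℝ` with `0 ≤ d x`
and `∑ x, d x = 1`. -/
abbrev Distr (X : Type*) [Fintype X] : Type _ := stdSimplex ℝ X

/-- The probability mass `d(T)` that a function `d` on states assigns to a set `T` of states. -/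
def mass {Q : Type*} (d : Q → ℝ) (T : Finset Q) : ℝ := ∑ q ∈ T, d q

/-- A Markov decision process with finite state set `Q` and finite action set `A`, given by its
probabilistic transition function. -/
structure MDP (Q A : Type*) [Fintype Q] where
  /-- `δ q a q'` is the probability that `q'` is the successor of `q` under the action `a`. -/
  δ : Q → A → Distr Q

/-- Finite sequences `q₀ a₀ q₁ a₁ … qₖ` with `k` actions and `k + 1` states. -/
abbrev History (Q A : Type*) (k : ℕ) : Type _ := (Fin (k + 1) → Q) × (Fin k → A)

/-- The prefix `q₀ a₀ q₁ … qⱼ` of a sequence `q₀ a₀ q₁ … qₖ`, for `j ≤ k`. -/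
def History.take {Q A : Type*} {k : ℕ} (ρ : History Q A k) (j : ℕ) (h : j ≤ k) :
    History Q A j :=
  (fun m => ρ.1 (Fin.castLE (Nat.succ_le_succ h) m), fun m => ρ.2 (Fin.castLE h m))

/-- Randomized history-dependent strategies: functions from `(Q A)* Q` to the distributions
over actions. -/
abbrev Strategy (Q A : Type*) [Fintype A] : Type _ := ∀ k : ℕ, History Q A k → Distr A

namespace MDP

variable {Q A : Type*} [Fintype Q] [Fintype A]

/-- The set of positive transition probabilities of an MDP. -/
def positiveProbs (M : MDP Q A) : Set ℝ := {p | 0 < p ∧ ∃ q a q', M.δ q a q' = p}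

/-- The probability of (the cylinder of) the finite sequence `ρ = q₀ a₀ q₁ … qₖ` from the initial
distribution `d₀` under the strategy `σ`:
`d₀(q₀) · ∏_{j < k} σ(q₀ a₀ … qⱼ)(aⱼ) · δ(qⱼ, aⱼ)(qⱼ₊₁)`. -/
noncomputable def prob (M : MDP Q A) (d₀ : Distr Q) (σ : Strategy Q A) {k : ℕ}
    (ρ : History Q A k) : ℝ :=
  d₀ (ρ.1 0) * ∏ j : Fin k,
    (σ j (ρ.take j j.2.le) (ρ.2 j) * M.δ (ρ.1 j.castSucc) (ρ.2 j) (ρ.1 j.succ))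

/-- The sequence of state distributions generated by `σ` from `d₀`: `M.outcome d₀ σ i q` is the
probability of being in `q` after exactly `i` steps, that is the total probability of the
(pairwise disjoint) cylinders of the sequences with `i` actions that end in `q`. -/
noncomputable def outcome [DecidableEq Q] (M : MDP Q A) (d₀ : Distr Q) (σ : Strategy Q A)
    (i : ℕ) (q : Q) : ℝ :=
  ∑ ρ : History Q A i, if ρ.1 (Fin.last i) = q then M.prob d₀ σ ρ else 0

end MDP

/-- A distribution is `p`-synchronized in `T` if it assigns mass at least `p` to `T`. -/
def IsSynchronized {Q : Type*} (p : ℝ) (d : Q → ℝ) (T : Finset Q) : Prop := p ≤ mass d T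

/-- A distribution is strictly `p`-synchronized in `T` if it assigns mass more than `p` to `T`. -/
def IsStrictlySynchronized {Q : Type*} (p : ℝ) (d : Q → ℝ) (T : Finset Q) : Prop := p < mass d T

/-- A sequence of distributions is weakly `p`-synchronizing in `T` if infinitely many of its
elements are `p`-synchronized in `T`. -/
def IsWeaklySynchronizing {Q : Type*} (p : ℝ) (d : ℕ → Q → ℝ) (T : Finset Q) : Prop :=
  {i : ℕ | IsSynchronized p (d i) T}.Infinite

/-- The almost-sure winning region for weakly synchronizing in `T`: the initial distributions
from which a single strategy is weakly `(1 - ε)`-synchronizing in `T` for all `ε > 0`. -/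
def MDP.almostSureWeakly {Q A : Type*} [Fintype Q] [Fintype A] [DecidableEq Q] (M : MDP Q A)
    (T : Finset Q) : Set (Distr Q) :=
  {d₀ | ∃ σ : Strategy Q A, ∀ ε : ℝ, 0 < ε → IsWeaklySynchronizing (1 - ε) (M.outcome d₀ σ) T}

/-! The contrapositive is proved: a strategy nearly synchronized in `T` at more than `2 ^ n`
positions yields a strategy that is almost-sure weakly synchronizing.

Pigeonhole (`mem_almostSureWeakly_of_positions`). At the `m`-th such position, let `S m` be the set
of states of `T` carrying mass at least `θ (m + 1)`, where `θ m = α₀ * b ^ m`, `b = α ^ K / n` and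
`K = (n + 1) * 2 ^ n`. Less than `n * θ (m + 1) = θ m * α ^ K` of the mass lies outside `S m`. Two
positions `i < j` share the same set `S`. Each state of `S` has mass at least `θ (i + 1) ≥ θ j` at
the earlier one, so from it some play misses `S` with probability below `α ^ K` at the later one.
Likewise from each initial state, whose mass is at least `α₀ = θ 0`.

Gap (`pow_le_miss`, `exists_winning`). The sets `M.sure S k` are periodic in `k`, with period `r`,
from some `k₀` on. Call the number of steps left until `S`, modulo `r`, the phase. There is a
phase-indexed winning region `W` in which `S` can be approached with error tending to 0, while
outside it every play misses `S` with probability at least `α ^ (k₀ + n * r) ≥ α ^ K`. A miss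
probability below `α ^ K` thus forces sure reachability (for short times) or membership in `W`; in
both cases `S ⊆ W t` for some phase `t`.

Repetition (`exists_reach_allPhases`, `exists_steps_of_recurrent`). After a round, the mass in `S`
is at phase `t`, but the small remainder is at another phase. It waits inside the winning region
until the phases agree again, so rounds with errors tending to 0 can be chained forever. -/

open scoped NNReal

namespace MDP

set_option linter.unusedSectionVars false

/-! ### Strategies as flows of measures -/

section

variable {Q A : Type*} [Fintype Q] [Fintype A]

/-- Transition probabilities as nonnegative reals. -/
noncomputable def tr (M : MDP Q A) (q : Q) (a : A) (q' : Q) : ℝ≥0 :=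
  ⟨M.δ q a q', (M.δ q a).2.1 q'⟩

lemma sum_tr (M : MDP Q A) (q : Q) (a : A) : ∑ q', M.tr q a q' = 1 := by
  apply NNReal.coe_injective
  push_cast
  exact (M.δ q a).2.2

/-- The measure `μ` can be moved to `ν` in one step by choosing actions. -/
def Step (M : MDP Q A) (μ ν : Q → ℝ≥0) : Prop :=
  ∃ f : Q → A → ℝ≥0, (∀ q, ∑ a, f q a = μ q) ∧ ∀ q', ∑ q, ∑ a, f q a * M.tr q a q' = ν q'

/-- The measure `μ` can be moved to `ν` in `k` steps by choosing actions. -/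
def Reach (M : MDP Q A) : ℕ → (Q → ℝ≥0) → (Q → ℝ≥0) → Prop
  | 0, μ, ν => μ = ν
  | k + 1, μ, ν => ∃ ρ, M.Step μ ρ ∧ Reach M k ρ ν

lemma Step.add {M : MDP Q A} {μ ν μ' ν' : Q → ℝ≥0} (h : M.Step μ ν) (h' : M.Step μ' ν') :
    M.Step (μ + μ') (ν + ν') := by
  obtain ⟨f, hf, hf'⟩ := h
  obtain ⟨g, hg, hg'⟩ := h'
  refine ⟨f + g, fun q => ?_, fun q' => ?_⟩
  · simp [Finset.sum_add_distrib, hf, hg]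
  · simp [Finset.sum_add_distrib, add_mul, hf', hg']

lemma Step.smul {M : MDP Q A} {μ ν : Q → ℝ≥0} (h : M.Step μ ν) (c : ℝ≥0) :
    M.Step (c • μ) (c • ν) := by
  obtain ⟨f, hf, hf'⟩ := h
  refine ⟨c • f, fun q => ?_, fun q' => ?_⟩
  · simp [← Finset.mul_sum, hf]
  · simp [← Finset.mul_sum, mul_assoc, hf']

lemma Step.zero (M : MDP Q A) : M.Step 0 0 := ⟨0, by simp, by simp⟩

lemma Step.sum_eq {M : MDP Q A} {μ ν : Q → ℝ≥0} (h : M.Step μ ν) :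
    ∑ q, ν q = ∑ q, μ q := by
  obtain ⟨f, hf, hf'⟩ := h
  simp_rw [← hf', ← hf]
  rw [Finset.sum_comm]
  refine Finset.sum_congr rfl fun q _ => ?_
  rw [Finset.sum_comm]
  refine Finset.sum_congr rfl fun a _ => ?_
  rw [← Finset.mul_sum, sum_tr, mul_one]

lemma Step.single [DecidableEq Q] (M : MDP Q A) (q : Q) (a : A) :
    M.Step (Pi.single q 1) (M.tr q a) := by
  classical
  refine ⟨Pi.single q (Pi.single a 1), fun q' => ?_, fun q' => ?_⟩
  · rcases eq_or_ne q' q with rfl | h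
    · simp
    · simp [Pi.single_eq_of_ne h]
  · rw [Finset.sum_eq_single q, Finset.sum_eq_single a] <;> simp +contextual

lemma Reach.add {M : MDP Q A} {k : ℕ} {μ ν μ' ν' : Q → ℝ≥0} (h : M.Reach k μ ν)
    (h' : M.Reach k μ' ν') : M.Reach k (μ + μ') (ν + ν') := by
  induction k generalizing μ μ' with
  | zero => exact congrArg₂ _ h h'
  | succ k ih =>
    obtain ⟨ρ, h₁, h₂⟩ := h
    obtain ⟨ρ', h₁', h₂'⟩ := h'
    exact ⟨_, h₁.add h₁', ih h₂ h₂'⟩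

lemma Reach.smul {M : MDP Q A} {k : ℕ} {μ ν : Q → ℝ≥0} (h : M.Reach k μ ν) (c : ℝ≥0) :
    M.Reach k (c • μ) (c • ν) := by
  induction k generalizing μ with
  | zero => exact congrArg _ h
  | succ k ih =>
    obtain ⟨ρ, h₁, h₂⟩ := h
    exact ⟨_, h₁.smul c, ih h₂⟩

lemma Reach.zero (M : MDP Q A) (k : ℕ) : M.Reach k 0 0 := by
  induction k with
  | zero => rfl
  | succ k ih => exact ⟨0, Step.zero M, ih⟩

lemma Reach.sum {M : MDP Q A} {k : ℕ} {ι : Type*} (s : Finset ι) {μ ν : ι → Q → ℝ≥0}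
    (h : ∀ i ∈ s, M.Reach k (μ i) (ν i)) : M.Reach k (∑ i ∈ s, μ i) (∑ i ∈ s, ν i) := by
  classical
  induction s using Finset.induction_on with
  | empty => simpa using Reach.zero M k
  | insert i s hi ih =>
    rw [Finset.sum_insert hi, Finset.sum_insert hi]
    exact (h i (by simp)).add (ih fun j hj => h j (by simp [hj]))

lemma Reach.trans {M : MDP Q A} {k l : ℕ} {μ ν ρ : Q → ℝ≥0} (h : M.Reach k μ ν)
    (h' : M.Reach l ν ρ) : M.Reach (k + l) μ ρ := by
  induction k generalizing μ with
  | zero => cases h; simpa using h'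
  | succ k ih =>
    obtain ⟨η, h₁, h₂⟩ := h
    rw [Nat.succ_add]
    exact ⟨η, h₁, ih h₂⟩

lemma Reach.sum_eq {M : MDP Q A} {k : ℕ} {μ ν : Q → ℝ≥0} (h : M.Reach k μ ν) :
    ∑ q, ν q = ∑ q, μ q := by
  induction k generalizing μ with
  | zero => cases h; rfl
  | succ k ih =>
    obtain ⟨ρ, h₁, h₂⟩ := h
    rw [ih h₂, h₁.sum_eq]

/-- Superposition: the trajectories of the point masses can be combined. -/
lemma Reach.of_single [DecidableEq Q] {M : MDP Q A} {k : ℕ} {μ : Q → ℝ≥0} {g : Q → Q → ℝ≥0}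
    (h : ∀ q, μ q ≠ 0 → M.Reach k (Pi.single q 1) (g q)) :
    M.Reach k μ (∑ q, μ q • g q) := by
  have key : M.Reach k (∑ q, μ q • Pi.single q 1) (∑ q, μ q • g q) := by
    refine Reach.sum _ fun q _ => ?_
    rcases eq_or_ne (μ q) 0 with h0 | h0
    · simpa [h0] using Reach.zero M k
    · exact (h q h0).smul _
  convert key using 1
  ext q
  simp [Finset.sum_apply, Pi.single_apply]

lemma Reach.of_steps {M : MDP Q A} {d : ℕ → Q → ℝ≥0} (hd : ∀ i, M.Step (d i) (d (i + 1)))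
    (i k : ℕ) : M.Reach k (d i) (d (i + k)) := by
  induction k generalizing i with
  | zero => rfl
  | succ k ih =>
    refine ⟨_, hd i, ?_⟩
    have := ih (i + 1)
    rwa [show i + 1 + k = i + (k + 1) by omega] at this

/-- Splitting a history into its last step and the preceding history. -/
def historySnocEquiv (Q A : Type*) (k : ℕ) : (History Q A k × A × Q) ≃ History Q A (k + 1) where
  toFun x := (Fin.snoc x.1.1 x.2.2, Fin.snoc x.1.2 x.2.1)
  invFun ρ := ((Fin.init ρ.1, Fin.init ρ.2), ρ.2 (Fin.last k), ρ.1 (Fin.last (k + 1)))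
  left_inv x := by
    obtain ⟨⟨x, y⟩, a, q⟩ := x
    simp [Fin.init_snoc, Fin.snoc_last]
  right_inv ρ := by
    obtain ⟨x, y⟩ := ρ
    simp [Fin.snoc_init_self]

lemma take_self {k : ℕ} (ρ : History Q A k) (h : k ≤ k) : ρ.take k h = ρ := rfl

lemma take_snoc {k : ℕ} (ρ : History Q A k) (a : A) (q : Q) (j : ℕ) (h : j ≤ k) :
    (historySnocEquiv Q A k (ρ, a, q)).take j (h.trans k.le_succ) = ρ.take j h := by
  refine Prod.ext (funext fun m => ?_) (funext fun m => ?_)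
  · exact Fin.snoc_castSucc (α := fun _ => Q) q ρ.1 (Fin.castLE (Nat.succ_le_succ h) m)
  · exact Fin.snoc_castSucc (α := fun _ => A) a ρ.2 (Fin.castLE h m)

lemma prob_snoc (M : MDP Q A) (d₀ : Distr Q) (σ : Strategy Q A) {k : ℕ}
    (ρ : History Q A k) (a : A) (q : Q) :
    M.prob d₀ σ (historySnocEquiv Q A k (ρ, a, q)) =
      M.prob d₀ σ ρ * (σ k ρ a * M.δ (ρ.1 (Fin.last k)) a q) := by
  have h1 : ∀ j : Fin (k + 1), (historySnocEquiv Q A k (ρ, a, q)).1 j.castSucc = ρ.1 j :=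
    fun j => Fin.snoc_castSucc (α := fun _ => Q) q ρ.1 j
  have h2 : ∀ j : Fin k, (historySnocEquiv Q A k (ρ, a, q)).2 j.castSucc = ρ.2 j :=
    fun j => Fin.snoc_castSucc (α := fun _ => A) a ρ.2 j
  have h3 : (historySnocEquiv Q A k (ρ, a, q)).2 (Fin.last k) = a :=
    Fin.snoc_last (α := fun _ => A) a ρ.2
  have h4 : (historySnocEquiv Q A k (ρ, a, q)).1 (Fin.last k).succ = q :=
    Fin.snoc_last (α := fun _ => Q) q ρ.1
  have h5 : (historySnocEquiv Q A k (ρ, a, q)).1 0 = ρ.1 0 := h1 0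
  unfold prob
  rw [Fin.prod_univ_castSucc, h5, h3, h4, h1, mul_assoc]
  congr 1
  congr 1
  · refine Finset.prod_congr rfl fun j _ => ?_
    rw [h2, h1, Fin.succ_castSucc, h1]
    congr 2
    exact congrArg (σ (j : ℕ)) (take_snoc ρ a q j j.2.le)
  · congr 1
    exact congrArg (fun x => (σ k x : A → ℝ) a) ((take_snoc ρ a q k le_rfl).trans (take_self ρ _))

lemma prob_nonneg (M : MDP Q A) (d₀ : Distr Q) (σ : Strategy Q A) {k : ℕ}
    (ρ : History Q A k) : 0 ≤ M.prob d₀ σ ρ :=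
  mul_nonneg (d₀.2.1 _) (Finset.prod_nonneg fun _ _ => mul_nonneg ((σ _ _).2.1 _) ((M.δ _ _).2.1 _))

variable [DecidableEq Q]

lemma outcome_zero (M : MDP Q A) (d₀ : Distr Q) (σ : Strategy Q A) (q : Q) :
    M.outcome d₀ σ 0 q = d₀ q := by
  unfold outcome
  rw [← (Equiv.prodUnique (Fin 1 → Q) (Fin 0 → A)).symm.sum_comp,
    ← (Equiv.funUnique (Fin 1) Q).symm.sum_comp]
  simp [prob]

lemma outcome_succ (M : MDP Q A) (d₀ : Distr Q) (σ : Strategy Q A) (k : ℕ) (q' : Q) :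
    M.outcome d₀ σ (k + 1) q' = ∑ ρ : History Q A k, ∑ a,
      M.prob d₀ σ ρ * (σ k ρ a * M.δ (ρ.1 (Fin.last k)) a q') := by
  unfold outcome
  rw [← (historySnocEquiv Q A k).sum_comp, Fintype.sum_prod_type]
  refine Finset.sum_congr rfl fun ρ _ => ?_
  rw [Fintype.sum_prod_type]
  refine Finset.sum_congr rfl fun a _ => ?_
  have h4 : ∀ q, (historySnocEquiv Q A k (ρ, a, q)).1 (Fin.last (k + 1)) = q :=
    fun q => Fin.snoc_last (α := fun _ => Q) q ρ.1
  simp_rw [h4, prob_snoc]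
  simp

lemma outcome_nonneg (M : MDP Q A) (d₀ : Distr Q) (σ : Strategy Q A) (k : ℕ) (q : Q) :
    0 ≤ M.outcome d₀ σ k q :=
  Finset.sum_nonneg fun ρ _ => by split_ifs; exacts [prob_nonneg M d₀ σ ρ, le_rfl]

/-- The outcome of a strategy, as a sequence of measures. -/
noncomputable def outcomeMeasure (M : MDP Q A) (d₀ : Distr Q) (σ : Strategy Q A) (k : ℕ) (q : Q) :
    ℝ≥0 := ⟨M.outcome d₀ σ k q, outcome_nonneg M d₀ σ k q⟩

/-- The flow through `(q, a)` is the total probability of the histories ending in `q` after which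
`a` is played; the memory of `σ` is averaged out. -/
lemma step_outcomeMeasure (M : MDP Q A) (d₀ : Distr Q) (σ : Strategy Q A) (k : ℕ) :
    M.Step (M.outcomeMeasure d₀ σ k) (M.outcomeMeasure d₀ σ (k + 1)) := by
  have hp : ∀ (ρ : History Q A k) a, 0 ≤ M.prob d₀ σ ρ * σ k ρ a :=
    fun ρ a => mul_nonneg (prob_nonneg M d₀ σ ρ) ((σ k ρ).2.1 a)
  refine ⟨fun q a => ∑ ρ : History Q A k, if ρ.1 (Fin.last k) = q then
    (M.prob d₀ σ ρ * σ k ρ a).toNNReal else 0, fun q => ?_, fun q' => ?_⟩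
  · apply NNReal.coe_injective
    push_cast
    rw [Finset.sum_comm]
    refine Finset.sum_congr rfl fun ρ _ => ?_
    simp only [apply_ite NNReal.toReal, Real.coe_toNNReal _ (hp ρ _)]
    split_ifs with h
    · have h1 : ∑ a, σ k ρ a = 1 := (σ k ρ).2.2
      rw [← Finset.mul_sum, h1, mul_one]
    · simp
  · apply NNReal.coe_injective
    push_cast
    refine Eq.trans ?_ (outcome_succ M d₀ σ k q').symm
    have : ∀ q, ∑ a, (∑ ρ : History Q A k,
          ((if ρ.1 (Fin.last k) = q then (M.prob d₀ σ ρ * σ k ρ a).toNNReal else 0 : ℝ≥0) : ℝ)) *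
            M.tr q a q' =
        ∑ ρ : History Q A k, if ρ.1 (Fin.last k) = q then
          ∑ a, M.prob d₀ σ ρ * (σ k ρ a * M.tr q a q') else 0 := by
      intro q
      simp_rw [Finset.sum_mul]
      rw [Finset.sum_comm]
      refine Finset.sum_congr rfl fun ρ _ => ?_
      simp only [apply_ite NNReal.toReal, Real.coe_toNNReal _ (hp ρ _)]
      split_ifs
      · exact Finset.sum_congr rfl fun a _ => by ring
      · simp
    simp_rw [this]
    rw [Finset.sum_comm]
    refine Finset.sum_congr rfl fun ρ _ => ?_
    simp only [Finset.sum_ite_eq, Finset.mem_univ, if_true]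
    rfl

/-- Every sequence of steps from an initial distribution is the outcome of a strategy. -/
lemma exists_strategy [Nonempty A] (M : MDP Q A) (d₀ : Distr Q) (d : ℕ → Q → ℝ≥0)
    (h0 : ∀ q, (d 0 q : ℝ) = d₀ q) (hd : ∀ i, M.Step (d i) (d (i + 1))) :
    ∃ σ : Strategy Q A, ∀ i q, M.outcome d₀ σ i q = d i q := by
  classical
  choose f hf hf' using hd
  -- Normalizing the flow gives a strategy that depends only on time and current state; where there
  -- is no mass, any action will do.
  have hx : ∀ i q, ∃ x : Distr A, ∀ a, (d i q : ℝ) * x a = f i q a := by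
    intro i q
    rcases eq_or_ne (d i q) 0 with h | h
    · obtain ⟨a₀⟩ := ‹Nonempty A›
      refine ⟨⟨Pi.single a₀ 1, single_mem_stdSimplex ℝ a₀⟩, fun a => ?_⟩
      have : f i q a = 0 := by
        have := hf i q
        rw [h, Finset.sum_eq_zero_iff] at this
        exact this a (Finset.mem_univ a)
      simp [h, this]
    · have h' : (d i q : ℝ) ≠ 0 := by exact_mod_cast h
      refine ⟨⟨fun a => f i q a / d i q, fun a => by positivity, ?_⟩, fun a => ?_⟩
      · rw [← Finset.sum_div, div_eq_one_iff_eq h', ← hf i q]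
        push_cast; rfl
      · change (d i q : ℝ) * (f i q a / d i q) = f i q a
        field_simp
  choose x hx using hx
  refine ⟨fun k ρ => x k (ρ.1 (Fin.last k)), fun i => ?_⟩
  induction i with
  | zero => intro q; rw [outcome_zero, h0]
  | succ k ih =>
    intro q'
    rw [outcome_succ, ← hf' k q']
    push_cast
    have : ∀ q, ∑ a, (f k q a : ℝ) * M.tr q a q' =
        ∑ ρ : History Q A k, if ρ.1 (Fin.last k) = q then
          ∑ a, M.prob d₀ (fun k ρ => x k (ρ.1 (Fin.last k))) ρ * (x k q a * M.tr q a q') else 0 := by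
      intro q
      simp_rw [← hx, ← ih q, outcome, Finset.sum_mul]
      rw [Finset.sum_comm]
      refine Finset.sum_congr rfl fun ρ _ => ?_
      split_ifs
      · exact Finset.sum_congr rfl fun a _ => by ring
      · simp
    simp_rw [this]
    symm
    rw [Finset.sum_comm]
    refine Finset.sum_congr rfl fun ρ _ => ?_
    simp only [Finset.sum_ite_eq, Finset.mem_univ, if_true]
    rfl

end

/-! ### Sure reachability and the least probability of missing a set -/

section

variable {Q A : Type*} [Fintype Q] [Fintype A]

/-- The mass that a measure assigns to the complement of `E`. -/
noncomputable def outside (E : Set Q) (μ : Q → ℝ≥0) : ℝ≥0 := ∑ q, Eᶜ.indicator μ q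

lemma outside_add (E : Set Q) (μ ν : Q → ℝ≥0) : outside E (μ + ν) = outside E μ + outside E ν := by
  simp [outside, Set.indicator_add', Finset.sum_add_distrib]

lemma outside_sum_smul (E : Set Q) (c : Q → ℝ≥0) (g : Q → Q → ℝ≥0) :
    outside E (∑ q, c q • g q) = ∑ q, c q * outside E (g q) := by
  simp only [outside, Finset.mul_sum]
  rw [Finset.sum_comm]
  refine Finset.sum_congr rfl fun q' _ => ?_
  by_cases h : q' ∈ Eᶜ <;> simp [h, Finset.sum_apply]

lemma outside_le_sum (E : Set Q) (μ : Q → ℝ≥0) : outside E μ ≤ ∑ q, μ q :=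
  Finset.sum_le_sum fun q _ => Set.indicator_le_self' (fun _ _ => zero_le) q

lemma outside_eq_zero {E : Set Q} {μ : Q → ℝ≥0} (h : Function.support μ ⊆ E) :
    outside E μ = 0 := by
  refine Finset.sum_eq_zero fun q _ => ?_
  by_cases hq : q ∈ E
  · simp [hq]
  · simp only [Set.mem_compl_iff, hq, not_false_eq_true, Set.indicator_of_mem]
    by_contra h0
    exact hq (h h0)

lemma outside_anti {E F : Set Q} (h : E ⊆ F) (μ : Q → ℝ≥0) : outside F μ ≤ outside E μ :=
  Finset.sum_le_sum fun q _ => Set.indicator_le_indicator_of_subset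
    (Set.compl_subset_compl.2 h) (fun _ => zero_le) q

lemma support_sum_smul_subset {E : Set Q} {c : Q → ℝ≥0} {g : Q → Q → ℝ≥0}
    (h : ∀ q, c q ≠ 0 → Function.support (g q) ⊆ E) :
    Function.support (∑ q, c q • g q) ⊆ E := by
  intro q' hq'
  simp only [Function.mem_support, Finset.sum_apply, Pi.smul_apply, smul_eq_mul] at hq'
  obtain ⟨q, -, hq⟩ := Finset.exists_ne_zero_of_sum_ne_zero hq'
  exact h q (left_ne_zero_of_mul hq) (right_ne_zero_of_mul hq)

lemma support_add_subset' {E : Set Q} {μ ν : Q → ℝ≥0} (hμ : Function.support μ ⊆ E)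
    (hν : Function.support ν ⊆ E) : Function.support (μ + ν) ⊆ E :=
  (Function.support_add μ ν).trans (Set.union_subset hμ hν)

/-- A time-indexed family of sets that can be followed for sure. -/
lemma exists_reach_of_closed (M : MDP Q A) (V : ℕ → Set Q)
    (hV : ∀ k, ∀ q ∈ V (k + 1), ∃ a, Function.support (M.tr q a) ⊆ V k) (k : ℕ) (μ : Q → ℝ≥0)
    (hμ : Function.support μ ⊆ V k) :
    ∃ ν, M.Reach k μ ν ∧ Function.support ν ⊆ V 0 := by
  classical
  induction k generalizing μ with
  | zero => exact ⟨μ, rfl, hμ⟩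
  | succ k ih =>
    have : ∀ q, ∃ ρ, μ q ≠ 0 → M.Reach 1 (Pi.single q 1) ρ ∧ Function.support ρ ⊆ V k := by
      intro q
      by_cases h : μ q = 0
      · exact ⟨0, fun h' => absurd h h'⟩
      · obtain ⟨a, ha⟩ := hV k q (hμ h)
        exact ⟨M.tr q a, fun _ => ⟨⟨_, Step.single M q a, rfl⟩, ha⟩⟩
    choose g hg using this
    have h1 := Reach.of_single (fun q hq => (hg q hq).1)
    obtain ⟨ν, hν, hν'⟩ := ih _ (support_sum_smul_subset fun q hq => (hg q hq).2)
    refine ⟨ν, ?_, hν'⟩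
    have := h1.trans hν
    rwa [add_comm] at this

/-- The set of states from which some action surely leads to `E`. -/
def pre (M : MDP Q A) (E : Set Q) : Set Q := {q | ∃ a, Function.support (M.tr q a) ⊆ E}

/-- The states from which `S` is surely reached after exactly `k` steps. -/
def sure (M : MDP Q A) (S : Set Q) (k : ℕ) : Set Q := M.pre^[k] S

lemma sure_succ (M : MDP Q A) (S : Set Q) (k : ℕ) : M.sure S (k + 1) = M.pre (M.sure S k) :=
  Function.iterate_succ_apply' _ _ _

lemma pre_mono (M : MDP Q A) : Monotone M.pre := fun _ _ h _ ⟨a, ha⟩ => ⟨a, ha.trans h⟩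

lemma exists_reach_sure (M : MDP Q A) (S : Set Q) (k : ℕ) (μ : Q → ℝ≥0)
    (hμ : Function.support μ ⊆ M.sure S k) :
    ∃ ν, M.Reach k μ ν ∧ Function.support ν ⊆ S :=
  exists_reach_of_closed M (M.sure S) (fun k q hq => by rwa [sure_succ] at hq) k μ hμ

lemma subset_sure_mul {M : MDP Q A} {S : Set Q} {k : ℕ} (h : S ⊆ M.sure S k) (j : ℕ) :
    S ⊆ M.sure S (j * k) := by
  induction j with
  | zero => simp [sure]
  | succ j ih =>
    have h1 : M.sure S (j * k) ⊆ M.pre^[j * k] (M.sure S k) := M.pre_mono.iterate _ h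
    have h2 : M.sure S ((j + 1) * k) = M.pre^[j * k] (M.sure S k) := by
      rw [sure, sure, ← Function.iterate_add_apply, Nat.succ_mul]
    rw [h2]
    exact ih.trans h1

/-- Each set determines the next, and there are only `2 ^ n` subsets of `Q`, so an early repetition
makes the sequence periodic. -/
lemma exists_sure_periodic (M : MDP Q A) (S : Set Q) :
    ∃ k₀ r, 0 < r ∧ k₀ + r ≤ 2 ^ Fintype.card Q ∧ ∀ k, k₀ ≤ k → M.sure S (k + r) = M.sure S k := by
  obtain ⟨i, j, hij, h⟩ := Fintype.exists_ne_map_eq_of_card_lt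
    (fun i : Fin (2 ^ Fintype.card Q + 1) => M.sure S i) (by simp)
  wlog hlt : i < j generalizing i j
  · exact this j i hij.symm h.symm (lt_of_le_of_ne (not_lt.1 hlt) hij.symm)
  refine ⟨i, j - i, Nat.sub_pos_of_lt hlt, ?_, fun k hk => ?_⟩
  · have := j.2
    have : (i : ℕ) < j := hlt
    omega
  · have : (i : ℕ) < j := hlt
    obtain ⟨l, rfl⟩ := Nat.exists_eq_add_of_le hk
    have h' : M.sure S j = M.sure S i := h.symm
    unfold sure at h' ⊢
    rw [show (i : ℕ) + l + (j - i) = l + j by omega, add_comm (i : ℕ) l,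
      Function.iterate_add_apply, h', Function.iterate_add_apply]

/-- The least probability of missing `S` after exactly `k` steps. -/
noncomputable def miss (M : MDP Q A) (S : Set Q) : ℕ → Q → ℝ≥0
  | 0 => Sᶜ.indicator 1
  | k + 1 => fun q => ⨅ a, ∑ q', M.tr q a q' * miss M S k q'

lemma miss_succ_le (M : MDP Q A) (S : Set Q) (k : ℕ) (q : Q) (a : A) :
    M.miss S (k + 1) q ≤ ∑ q', M.tr q a q' * M.miss S k q' :=
  ciInf_le (OrderBot.bddBelow _) a

lemma exists_miss_succ_eq [Nonempty A] (M : MDP Q A) (S : Set Q) (k : ℕ) (q : Q) :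
    ∃ a, M.miss S (k + 1) q = ∑ q', M.tr q a q' * M.miss S k q' := by
  obtain ⟨a, ha⟩ := exists_eq_ciInf_of_finite (f := fun a => ∑ q', M.tr q a q' * M.miss S k q')
  exact ⟨a, ha.symm⟩

/-- `miss` is the value function of backward induction, so no choice of actions beats it. -/
lemma Reach.sum_mul_miss_le {M : MDP Q A} {S : Set Q} {k : ℕ} {μ ν : Q → ℝ≥0}
    (h : M.Reach k μ ν) : ∑ q, μ q * M.miss S k q ≤ outside S ν := by
  induction k generalizing μ with
  | zero =>
    cases h
    refine (Finset.sum_congr rfl fun q _ => ?_).le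
    by_cases hq : q ∈ S <;> simp [miss, hq]
  | succ k ih =>
    obtain ⟨ρ, ⟨f, hf, hf'⟩, h₂⟩ := h
    refine le_trans ?_ (ih h₂)
    simp_rw [← hf, ← hf', Finset.sum_mul]
    calc ∑ q, ∑ a, f q a * M.miss S (k + 1) q
        ≤ ∑ q, ∑ a, f q a * ∑ q', M.tr q a q' * M.miss S k q' := by
          gcongr with q _ a _
          exact miss_succ_le M S k q a
      _ = ∑ q, ∑ a, ∑ q', f q a * M.tr q a q' * M.miss S k q' := by
          simp_rw [Finset.mul_sum, mul_assoc]
      _ = ∑ q, ∑ q', ∑ a, f q a * M.tr q a q' * M.miss S k q' :=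
          Finset.sum_congr rfl fun q _ => Finset.sum_comm
      _ = _ := Finset.sum_comm

variable {M : MDP Q A} {α : ℝ≥0}

lemma le_sum_tr_mul (hα : ∀ q a q', M.tr q a q' ≠ 0 → α ≤ M.tr q a q') {c : ℝ≥0}
    {w : Q → ℝ≥0} {q q' : Q} {a : A} (hq' : M.tr q a q' ≠ 0) (hc : c ≤ w q') :
    α * c ≤ ∑ q', M.tr q a q' * w q' :=
  (mul_le_mul' (hα q a q' hq') hc).trans
    (Finset.single_le_sum (f := fun q' => M.tr q a q' * w q') (fun _ _ => zero_le)
      (Finset.mem_univ q'))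

/-- Every action, even the optimal one, has a positive-probability successor that again cannot reach
`S` for sure; each such transition costs at most a factor `α`. -/
lemma pow_le_miss [Nonempty A] (hα : ∀ q a q', M.tr q a q' ≠ 0 → α ≤ M.tr q a q') {S : Set Q}
    {k : ℕ} {q : Q} (hq : q ∉ M.sure S k) : α ^ k ≤ M.miss S k q := by
  induction k generalizing q with
  | zero => simp [miss, show q ∉ S from hq]
  | succ k ih =>
    obtain ⟨a, ha⟩ := exists_miss_succ_eq M S k q
    rw [ha, pow_succ']
    rw [sure_succ] at hq
    have : ¬ Function.support (M.tr q a) ⊆ M.sure S k := fun h => hq ⟨a, h⟩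
    obtain ⟨q', h1, h2⟩ := Set.not_subset.1 this
    exact le_sum_tr_mul hα h1 (ih h2)

lemma miss_eq_zero {S : Set Q} {k : ℕ} {q : Q} (hq : q ∈ M.sure S k) : M.miss S k q = 0 := by
  induction k generalizing q with
  | zero => simp [miss, show q ∈ S from hq]
  | succ k ih =>
    rw [sure_succ] at hq
    obtain ⟨a, ha⟩ := hq
    refine le_antisymm ((miss_succ_le M S k q a).trans ?_) zero_le
    refine (Finset.sum_eq_zero fun q' _ => ?_).le
    by_cases h : M.tr q a q' = 0
    · simp [h]
    · simp [ih (ha h)]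

/-! ### The winning region and the gap outside it -/

/-- The state `q` can reach a target set `R` with positive probability, in a number of steps
that takes the phase to that of the target, without ever risking to leave `W`. -/
inductive Hit (M : MDP Q A) {r : ℕ} (W R : ZMod r → Set Q) : Q → ZMod r → Prop
  | base {q s} : q ∈ R s → Hit M W R q s
  | step {q s a q'} : Function.support (M.tr q a) ⊆ W s → M.tr q a q' ≠ 0 → Hit M W R q' s →
      Hit M W R q (s + 1)

/-- A monotone sequence of sets in a finite type is stationary at some small index. -/
lemma exists_stationary {X : Type*} [Fintype X] (f : ℕ → Set X) (hf : Monotone f) :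
    ∃ m ≤ Fintype.card X, f m = f (m + 1) := by
  by_contra! h
  have key : ∀ m ≤ Fintype.card X + 1, m ≤ (f m).ncard := by
    intro m
    induction m with
    | zero => simp
    | succ m ih =>
      intro hm
      have h1 := ih (by omega)
      have h2 : f m ⊂ f (m + 1) := (hf m.le_succ).ssubset_of_ne (h m (by omega))
      have := Set.ncard_lt_ncard h2 (Set.toFinite _)
      omega
  have h1 := key _ le_rfl
  have h2 := Set.ncard_le_card (f (Fintype.card X + 1))
  rw [Nat.card_eq_fintype_card] at h2
  omega

/-- The states from which `S` is surely reached after any sufficiently large number of steps in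
the residue class `s`. -/
def sureClass (M : MDP Q A) (S : Set Q) (k₀ r : ℕ) (s : ZMod r) : Set Q :=
  {q | ∃ k, k₀ ≤ k ∧ (k : ZMod r) = s ∧ q ∈ M.sure S k}

lemma sure_eq_of_cast_eq {S : Set Q} {k₀ r : ℕ}
    (hper : ∀ k, k₀ ≤ k → M.sure S (k + r) = M.sure S k) {k l : ℕ} (hk : k₀ ≤ k) (hl : k₀ ≤ l)
    (h : (k : ZMod r) = l) : M.sure S k = M.sure S l := by
  wlog hkl : k ≤ l generalizing k l
  · exact (this hl hk h.symm (le_of_not_ge hkl)).symm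
  have hd : r ∣ l - k := (Nat.modEq_iff_dvd' hkl).1 ((ZMod.natCast_eq_natCast_iff _ _ _).1 h)
  obtain ⟨m, hm⟩ := hd
  obtain rfl : l = k + r * m := by omega
  clear h hl hkl hm
  induction m with
  | zero => rfl
  | succ m ih => rw [Nat.mul_succ, ← add_assoc, hper _ (by omega), ih]

lemma sureClass_cast {S : Set Q} {k₀ r : ℕ}
    (hper : ∀ k, k₀ ≤ k → M.sure S (k + r) = M.sure S k) {k : ℕ} (hk : k₀ ≤ k) :
    M.sureClass S k₀ r k = M.sure S k := by
  ext q
  constructor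
  · rintro ⟨l, hl, h, hq⟩
    rwa [← sure_eq_of_cast_eq hper hl hk h]
  · exact fun hq => ⟨k, hk, rfl, hq⟩

lemma exists_cast_eq {r : ℕ} [NeZero r] (s : ZMod r) (N : ℕ) : ∃ k, N ≤ k ∧ (k : ZMod r) = s := by
  refine ⟨s.val + r * N, ?_, by simp⟩
  have := Nat.le_mul_of_pos_left N (NeZero.pos r)
  omega

lemma pre_sureClass {S : Set Q} {k₀ r : ℕ} [NeZero r]
    (hper : ∀ k, k₀ ≤ k → M.sure S (k + r) = M.sure S k) (s : ZMod r) (q : Q)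
    (hq : q ∈ M.sureClass S k₀ r (s + 1)) :
    ∃ a, Function.support (M.tr q a) ⊆ M.sureClass S k₀ r s := by
  obtain ⟨k, hk, rfl⟩ := exists_cast_eq s k₀
  have : ((k : ZMod r) + 1) = ((k + 1 : ℕ) : ZMod r) := by push_cast; rfl
  rw [this, sureClass_cast hper (by omega), sure_succ] at hq
  rwa [sureClass_cast hper hk]

/-- The states that can almost surely synchronize in `S` at some phase, and the quantitative
loss outside of them. -/
lemma exists_winning [Nonempty A] (hα : ∀ q a q', M.tr q a q' ≠ 0 → α ≤ M.tr q a q') (hα0 : α ≠ 0)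
    (hα1 : α ≤ 1) (S : Set Q) {k₀ r : ℕ} [NeZero r]
    (hper : ∀ k, k₀ ≤ k → M.sure S (k + r) = M.sure S k) :
    ∃ W : ZMod r → Set Q, (∀ s, M.sureClass S k₀ r s ⊆ W s) ∧
      (∀ s, ∀ q ∈ W s, M.Hit W (M.sureClass S k₀ r) q s) ∧
      ∀ s, ∀ q ∉ W s, ∀ k, k₀ ≤ k → (k : ZMod r) = s →
        α ^ (k₀ + Fintype.card Q * r) ≤ M.miss S k q := by
  -- `Z m` collects the losing pairs at level `m`. They increase with `m` inside a set of `n * r`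
  -- pairs, so they stall at some `m ≤ n * r`; the winning region is the complement at that level.
  set Z : ℕ → Set (Q × ZMod r) := fun m =>
    {x | ∀ k, k₀ ≤ k → (k : ZMod r) = x.2 → α ^ (k₀ + m) ≤ M.miss S k x.1} with hZ
  have hmono : Monotone Z := fun m m' hm x hx k hk hks =>
    (pow_le_pow_of_le_one zero_le hα1 (by omega)).trans (hx k hk hks)
  obtain ⟨m, hm, hst⟩ := exists_stationary Z hmono
  rw [Fintype.card_prod, ZMod.card] at hm
  refine ⟨fun s => {q | (q, s) ∉ Z m}, ?_, ?_, ?_⟩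
  · rintro s q ⟨k, hk, hks, hq⟩ hqZ
    have := hqZ k hk hks
    simp only [miss_eq_zero hq] at this
    exact pow_ne_zero _ hα0 (le_antisymm this zero_le)
  · intro s q hq
    by_contra hhit
    refine hq ?_
    rw [hst]
    set W : ZMod r → Set Q := fun s => {q | (q, s) ∉ Z m} with hW
    -- A pair in `W` without `Hit` would lie in `Z (m + 1) = Z m`. An action staying in `W` leads
    -- only to states without `Hit`, where the bound is inductive; an action that risks leaving `W`
    -- costs one factor `α` on top of the level-`m` bound.
    have key : ∀ j q, q ∈ W ((k₀ + j : ℕ) : ZMod r) →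
        ¬ M.Hit W (M.sureClass S k₀ r) q ((k₀ + j : ℕ) : ZMod r) →
        α ^ (k₀ + (m + 1)) ≤ M.miss S (k₀ + j) q := by
      intro j
      induction j with
      | zero =>
        intro q _ hq
        refine (pow_le_pow_of_le_one zero_le hα1 (by omega)).trans
          (pow_le_miss hα (k := k₀) fun h => hq (Hit.base ?_))
        rwa [sureClass_cast hper (by omega)]
      | succ j ih =>
        intro q hqW hq
        rw [← add_assoc k₀ m, ← add_assoc k₀ j]
        obtain ⟨a, ha⟩ := exists_miss_succ_eq M S (k₀ + j) q
        rw [ha]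
        have hcast : ((k₀ + (j + 1) : ℕ) : ZMod r) = ((k₀ + j : ℕ) : ZMod r) + 1 := by
          push_cast; ring
        rw [hcast] at hq
        by_cases hsafe : Function.support (M.tr q a) ⊆ W ((k₀ + j : ℕ) : ZMod r)
        · calc α ^ (k₀ + m + 1) = ∑ q', M.tr q a q' * α ^ (k₀ + m + 1) := by
                rw [← Finset.sum_mul, sum_tr, one_mul]
            _ ≤ _ := by
              refine Finset.sum_le_sum fun q' _ => ?_
              by_cases h0 : M.tr q a q' = 0
              · simp [h0]
              · exact mul_le_mul_right (ih q' (hsafe h0) fun h => hq (Hit.step hsafe h0 h)) _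
        · obtain ⟨q', h1, h2⟩ := Set.not_subset.1 hsafe
          have h3 : (q', ((k₀ + j : ℕ) : ZMod r)) ∈ Z m := not_not.1 h2
          rw [pow_succ']
          exact le_sum_tr_mul hα h1 (h3 _ (by omega) rfl)
    intro k hk hks
    obtain ⟨j, rfl⟩ := Nat.exists_eq_add_of_le hk
    simp only at hks
    subst hks
    exact key j q hq hhit
  · intro s q hq k hk hks
    exact (pow_le_pow_of_le_one zero_le hα1 (by omega)).trans ((not_not.1 hq) k hk hks)

end

/-! ### Approaching the target inside the winning region -/

section

variable {Q A : Type*} [Fintype Q] [Fintype A] {M : MDP Q A}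

/-- A phase-indexed family of sets that can be followed for sure. -/
lemma exists_reach_phase {r : ℕ} {V : ZMod r → Set Q}
    (hV : ∀ s, ∀ q ∈ V (s + 1), ∃ a, Function.support (M.tr q a) ⊆ V s) {k : ℕ} {s s' : ZMod r}
    (hs : s = s' + k) {μ : Q → ℝ≥0} (hμ : Function.support μ ⊆ V s) :
    ∃ ν, M.Reach k μ ν ∧ Function.support ν ⊆ V s' := by
  have := exists_reach_of_closed M (fun i => V (s' + i))
    (fun i q hq => hV _ q (by simpa [add_assoc] using hq)) k μ (by rwa [← hs])
  simpa using this

/-- Splitting a measure into its parts inside and outside a set. -/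
lemma indicator_add_indicator_compl (E : Set Q) (μ : Q → ℝ≥0) :
    E.indicator μ + Eᶜ.indicator μ = μ := Set.indicator_self_add_compl E μ

section Phase

variable {r : ℕ} {W R : ZMod r → Set Q}

/-- The first action of a `Hit` derivation is safe by definition, and a state already in `R` can
follow `R ⊆ W`. -/
lemma Hit.mem_of_subset (hRW : ∀ s, R s ⊆ W s)
    (hR : ∀ s, ∀ q ∈ R (s + 1), ∃ a, Function.support (M.tr q a) ⊆ R s)
    (hW : ∀ s, ∀ q ∈ W s, M.Hit W R q s) (s : ZMod r) (q : Q) (hq : q ∈ W (s + 1)) :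
    ∃ a, Function.support (M.tr q a) ⊆ W s := by
  have h := hW _ q hq
  generalize hs : s + 1 = s' at h
  cases h with
  | base h =>
    subst hs
    obtain ⟨a, ha⟩ := hR s q h
    exact ⟨a, ha.trans (hRW s)⟩
  | step h _ _ =>
    obtain rfl := add_right_cancel hs
    exact ⟨_, h⟩

/-- Mass that enters `R` can be kept there, so a single lucky path suffices. For the same reason
every longer time works too, which allows one `L` common to all states and phases. -/
lemma Hit.exists_reach_outside_lt [DecidableEq Q] (hRW : ∀ s, R s ⊆ W s)
    (hR : ∀ s, ∀ q ∈ R (s + 1), ∃ a, Function.support (M.tr q a) ⊆ R s)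
    (hW : ∀ s, ∀ q ∈ W s, M.Hit W R q s) {q : Q} {s : ZMod r} (h : M.Hit W R q s) :
    ∃ L₀ : ℕ, ∀ L, L₀ ≤ L → ∃ ν, M.Reach L (Pi.single q 1) ν ∧ Function.support ν ⊆ W (s - L) ∧
      outside (R (s - L)) ν < 1 := by
  have hWc := Hit.mem_of_subset hRW hR hW
  induction h with
  | @base q s hq =>
    refine ⟨0, fun L _ => ?_⟩
    obtain ⟨ν, h1, h2⟩ := exists_reach_phase hR (k := L) (s' := s - L) (s := s) (by ring)
      (μ := Pi.single q 1) (by simpa using hq)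
    exact ⟨ν, h1, h2.trans (hRW _), by simp [outside_eq_zero h2]⟩
  | @step q s a q' ha hq' _ ih =>
    obtain ⟨L₀, hL₀⟩ := ih
    refine ⟨L₀ + 1, fun L hL => ?_⟩
    obtain ⟨L, rfl⟩ : ∃ l, L = 1 + l := ⟨L - 1, by omega⟩
    have hs : s + 1 - ((1 + L : ℕ) : ZMod r) = s - L := by push_cast; ring
    rw [hs]
    obtain ⟨ν, hν, hνW, hνR⟩ := hL₀ L (by omega)
    have : ∀ p, ∃ ρ, M.tr q a p ≠ 0 → M.Reach L (Pi.single p 1) ρ ∧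
        Function.support ρ ⊆ W (s - L) := by
      intro p
      by_cases h : M.tr q a p = 0
      · exact ⟨0, fun h' => absurd h h'⟩
      · obtain ⟨ρ, h1, h2⟩ := exists_reach_phase hWc (k := L) (s' := s - L) (s := s) (by ring)
          (μ := Pi.single p 1) (by simpa using ha h)
        exact ⟨ρ, fun _ => ⟨h1, h2⟩⟩
    choose g hg using this
    have hg' : ∀ p, M.tr q a p ≠ 0 → M.Reach L (Pi.single p 1) (Function.update g q' ν p) ∧
        Function.support (Function.update g q' ν p) ⊆ W (s - L) := by
      intro p hp
      rcases eq_or_ne p q' with rfl | hne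
      · simpa using ⟨hν, hνW⟩
      · simpa [Function.update_of_ne hne] using hg p hp
    refine ⟨_, Reach.trans ⟨_, Step.single M q a, rfl⟩
      (Reach.of_single fun p hp => (hg' p hp).1),
      support_sum_smul_subset fun p hp => (hg' p hp).2, ?_⟩
    rw [outside_sum_smul]
    calc _ < ∑ p, M.tr q a p * 1 := by
          refine Finset.sum_lt_sum (fun p _ => ?_) ⟨q', Finset.mem_univ _, ?_⟩
          · by_cases hp : M.tr q a p = 0
            · simp [hp]
            · refine mul_le_mul_right ((outside_le_sum _ _).trans ?_) _
              rw [(hg' p hp).1.sum_eq]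
              simp
          · rw [Function.update_self]
            exact mul_lt_mul_of_pos_left hνR (pos_iff_ne_zero.2 hq')
      _ = 1 := by simp [sum_tr]

/-- The constant `c` is a maximum of finitely many numbers below 1. Mass already in `R` stays there
and contributes nothing. -/
lemma exists_uniform_contraction [DecidableEq Q] [NeZero r] (hRW : ∀ s, R s ⊆ W s)
    (hR : ∀ s, ∀ q ∈ R (s + 1), ∃ a, Function.support (M.tr q a) ⊆ R s)
    (hW : ∀ s, ∀ q ∈ W s, M.Hit W R q s) :
    ∃ (L : ℕ) (c : ℝ≥0), c < 1 ∧ ∀ (s : ZMod r) (μ : Q → ℝ≥0), Function.support μ ⊆ W s →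
      ∃ ν, M.Reach L μ ν ∧ Function.support ν ⊆ W (s - L) ∧
        outside (R (s - L)) ν ≤ c * outside (R s) μ := by
  have h1 : ∀ x : Q × ZMod r, ∃ L₀ : ℕ, x.1 ∈ W x.2 → ∀ L, L₀ ≤ L →
      ∃ ν, M.Reach L (Pi.single x.1 1) ν ∧ Function.support ν ⊆ W (x.2 - L) ∧
        outside (R (x.2 - L)) ν < 1 := by
    intro x
    by_cases h : x.1 ∈ W x.2
    · obtain ⟨L₀, hL₀⟩ := (hW _ _ h).exists_reach_outside_lt hRW hR hW
      exact ⟨L₀, fun _ => hL₀⟩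
    · exact ⟨0, fun h' => absurd h' h⟩
  choose L₀ hL₀ using h1
  set L := Finset.univ.sup L₀
  have h2 : ∀ x : Q × ZMod r, ∃ ν, x.1 ∈ W x.2 → M.Reach L (Pi.single x.1 1) ν ∧
      Function.support ν ⊆ W (x.2 - L) ∧ outside (R (x.2 - L)) ν < 1 := by
    intro x
    by_cases h : x.1 ∈ W x.2
    · obtain ⟨ν, hν⟩ := hL₀ x h L (Finset.le_sup (Finset.mem_univ x))
      exact ⟨ν, fun _ => hν⟩
    · exact ⟨0, fun h' => absurd h' h⟩
  choose g hg using h2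
  set c : ℝ≥0 := Finset.univ.sup fun x : Q × ZMod r =>
    open Classical in if x.1 ∈ W x.2 then outside (R (x.2 - L)) (g x) else 0
  refine ⟨L, c, ?_, fun s μ hμ => ?_⟩
  · refine (Finset.sup_lt_iff (by simp)).2 fun x _ => ?_
    split_ifs with h
    · exact (hg x h).2.2
    · exact one_pos
  · have h3 : ∀ q, ∃ ν, μ q ≠ 0 → M.Reach L (Pi.single q 1) ν ∧ Function.support ν ⊆ W (s - L) ∧
        outside (R (s - L)) ν ≤ c * (R s)ᶜ.indicator 1 q := by
      intro q
      by_cases h0 : μ q = 0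
      · exact ⟨0, fun h => absurd h0 h⟩
      by_cases hq : q ∈ R s
      · obtain ⟨ν, h1, h2⟩ := exists_reach_phase hR (k := L) (s' := s - L) (s := s) (by ring)
          (μ := Pi.single q 1) (by simpa using hq)
        exact ⟨ν, fun _ => ⟨h1, h2.trans (hRW _), by simp [outside_eq_zero h2]⟩⟩
      · obtain ⟨h1, h2, -⟩ := hg (q, s) (hμ h0)
        refine ⟨_, fun _ => ⟨h1, h2, ?_⟩⟩
        have := Finset.le_sup (f := fun x : Q × ZMod r =>
            open Classical in if x.1 ∈ W x.2 then outside (R (x.2 - L)) (g x) else 0)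
            (Finset.mem_univ (q, s))
        rw [if_pos (show (q, s).1 ∈ W (q, s).2 from hμ h0)] at this
        change _ ≤ c at this
        simpa [hq] using this
    choose f hf using h3
    refine ⟨_, Reach.of_single fun q hq => (hf q hq).1,
      support_sum_smul_subset fun q hq => (hf q hq).2.1, ?_⟩
    rw [outside_sum_smul, outside, Finset.mul_sum]
    refine Finset.sum_le_sum fun q _ => ?_
    by_cases h0 : μ q = 0
    · simp [h0]
    · refine (mul_le_mul_right (hf q h0).2.2 _).trans (le_of_eq ?_)
      by_cases hq : q ∈ R s
      · simp [hq]
      · simp [hq, mul_comm]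

lemma exists_reach_outside_le [DecidableEq Q] [NeZero r] (hRW : ∀ s, R s ⊆ W s)
    (hR : ∀ s, ∀ q ∈ R (s + 1), ∃ a, Function.support (M.tr q a) ⊆ R s)
    (hW : ∀ s, ∀ q ∈ W s, M.Hit W R q s) {s : ZMod r} {μ : Q → ℝ≥0}
    (hμ : Function.support μ ⊆ W s) {ε : ℝ≥0} (hε : ε ≠ 0) :
    ∃ (L : ℕ) (ν : _), M.Reach L μ ν ∧ Function.support ν ⊆ W (s - L) ∧
      outside (R (s - L)) ν ≤ ε := by
  obtain ⟨L, c, hc, h⟩ := exists_uniform_contraction hRW hR hW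
  have key : ∀ m : ℕ, ∃ (l : ℕ) (ν : _), M.Reach l μ ν ∧ Function.support ν ⊆ W (s - l) ∧
      outside (R (s - l)) ν ≤ c ^ m * outside (R s) μ := by
    intro m
    induction m with
    | zero => exact ⟨0, μ, rfl, by simpa using hμ, by simp⟩
    | succ m ih =>
      obtain ⟨l, ν, h1, h2, h3⟩ := ih
      obtain ⟨ρ, h4, h5, h6⟩ := h _ ν h2
      refine ⟨l + L, ρ, h1.trans h4, by simpa [sub_sub] using h5, ?_⟩
      rw [Nat.cast_add, ← sub_sub, pow_succ', mul_assoc]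
      exact h6.trans (mul_le_mul_right h3 _)
  have hlim : Filter.Tendsto (fun m : ℕ => c ^ m * outside (R s) μ) Filter.atTop (nhds 0) := by
    simpa using (NNReal.tendsto_pow_atTop_nhds_zero_of_lt_one hc).mul_const (outside (R s) μ)
  obtain ⟨m, hm⟩ := (hlim.eventually (gt_mem_nhds (pos_iff_ne_zero.2 hε))).exists
  obtain ⟨l, ν, h1, h2, h3⟩ := key m
  exact ⟨l, ν, h1, h2, h3.trans hm.le⟩

end Phase

/-! ### Repeated synchronization across phases -/

section Synchronize

variable {S : Set Q} {k₀ r : ℕ} {W : ZMod r → Set Q}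

/-- Mass in the winning region is synchronized in `S` up to `ε` at a suitable time, and the rest
stays in the winning region. -/
lemma exists_reach_split [DecidableEq Q] [NeZero r]
    (hper : ∀ k, k₀ ≤ k → M.sure S (k + r) = M.sure S k)
    (hRW : ∀ s, M.sureClass S k₀ r s ⊆ W s)
    (hW : ∀ s, ∀ q ∈ W s, M.Hit W (M.sureClass S k₀ r) q s) {s : ZMod r} {μ : Q → ℝ≥0}
    (hμ : Function.support μ ⊆ W s) {ε : ℝ≥0} (hε : ε ≠ 0) :
    ∃ (k : ℕ) (ν ν' : Q → ℝ≥0), 1 ≤ k ∧ (k : ZMod r) = s ∧ M.Reach k μ (ν + ν') ∧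
      Function.support ν ⊆ S ∧ Function.support ν' ⊆ W 0 ∧ ∑ q, ν' q ≤ ε := by
  have hR := pre_sureClass (M := M) (S := S) (k₀ := k₀) (r := r) hper
  have hWc := Hit.mem_of_subset hRW hR hW
  obtain ⟨L, ρ, h1, h2, h3⟩ := exists_reach_outside_le hRW hR hW hμ hε
  -- Periodicity only needs `k₀`; the extra 1 guarantees that a round takes at least one step.
  obtain ⟨k, hk, hks⟩ := exists_cast_eq (s - (L : ZMod r)) (k₀ + 1)
  set E := M.sureClass S k₀ r (s - L) with hE
  have hEk : E = M.sure S k := by rw [hE, ← hks, sureClass_cast hper (by omega)]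
  obtain ⟨ν, h4, h5⟩ := exists_reach_sure M S k (E.indicator ρ)
    (hEk ▸ Set.support_indicator_subset)
  obtain ⟨ν', h6, h7⟩ := exists_reach_phase hWc (k := k) (s' := 0) (s := s - L) (by simp [hks])
    (μ := Eᶜ.indicator ρ) (by
      rw [Set.support_indicator]; exact Set.inter_subset_right.trans h2)
  have h8 := h4.add h6
  rw [indicator_add_indicator_compl] at h8
  refine ⟨L + k, ν, ν', by omega, by push_cast; rw [hks]; ring, h1.trans h8, h5, h7, ?_⟩
  rw [h6.sum_eq]
  exact h3

/-- The winning region, over all the phases that arise from synchronizing in `S` repeatedly, when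
`S` itself is winning at phase `t`. -/
def allPhases (W : ZMod r → Set Q) (t s : ZMod r) : Set Q := ⋃ i : ℕ, W (s + i * t)

/-- Induction on the number of rounds. Bringing the part in `W s` to `S ⊆ W t` aligns it with the
part in `W (s + t)`, which has meanwhile arrived at phase `t`; each round thus absorbs one more
phase. -/
lemma exists_reach_split_phases [DecidableEq Q] [NeZero r]
    (hper : ∀ k, k₀ ≤ k → M.sure S (k + r) = M.sure S k)
    (hRW : ∀ s, M.sureClass S k₀ r s ⊆ W s)
    (hW : ∀ s, ∀ q ∈ W s, M.Hit W (M.sureClass S k₀ r) q s) {t : ZMod r} (ht : S ⊆ W t) (j : ℕ) :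
    ∀ (s : ZMod r) (μ : Q → ℝ≥0), Function.support μ ⊆ ⋃ i ≤ j, W (s + i * t) →
    ∀ ε : ℝ≥0, ε ≠ 0 → ∃ (k : ℕ) (ν ν' : Q → ℝ≥0), 1 ≤ k ∧ s + j * t = k ∧
      M.Reach k μ (ν + ν') ∧ Function.support ν ⊆ S ∧
      Function.support ν' ⊆ allPhases W t (s - k) ∧ ∑ q, ν' q ≤ ε := by
  have hR := pre_sureClass (M := M) (S := S) (k₀ := k₀) (r := r) hper
  have hWc := Hit.mem_of_subset hRW hR hW
  induction j with
  | zero =>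
    intro s μ hμ ε hε
    obtain ⟨k, ν, ν', hk, hks, h1, h2, h3, h4⟩ :=
      exists_reach_split hper hRW hW (s := s) (μ := μ) (by simpa using hμ) hε
    refine ⟨k, ν, ν', hk, by simp [hks], h1, h2, h3.trans ?_, h4⟩
    rw [hks, sub_self]
    exact (Set.subset_iUnion (fun i : ℕ => W (0 + i * t)) 0).trans' (by simp)
  | succ j ih =>
    intro s μ hμ ε hε
    have hε2 : ε / 2 ≠ 0 := by simpa using hε
    obtain ⟨k, ν, ν', hk, hks, h1, h2, h3, h4⟩ :=
      exists_reach_split hper hRW hW (s := s) (μ := (W s).indicator μ)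
        Set.support_indicator_subset hε2
    have hV : ∀ p, ∀ q ∈ ⋃ i ≤ j, W (p + 1 + ((i + 1 : ℕ) : ZMod r) * t),
        ∃ a, Function.support (M.tr q a) ⊆ ⋃ i ≤ j, W (p + ((i + 1 : ℕ) : ZMod r) * t) := by
      intro p q hq
      simp only [Set.mem_iUnion] at hq
      obtain ⟨i, hi, hq⟩ := hq
      rw [add_right_comm] at hq
      obtain ⟨a, ha⟩ := hWc _ q hq
      exact ⟨a, ha.trans (Set.subset_biUnion_of_mem
        (u := fun i : ℕ => W (p + ((i + 1 : ℕ) : ZMod r) * t)) hi)⟩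
    obtain ⟨ρ, h5, h6⟩ := exists_reach_phase (V := fun p => ⋃ i ≤ j, W (p + ((i + 1 : ℕ) : ZMod r) * t))
      hV (k := k) (s := s) (s' := 0) (by simp [hks]) (μ := (W s)ᶜ.indicator μ) (by
        rw [Set.support_indicator]
        rintro q ⟨hq, hq'⟩
        have := hμ hq'
        simp only [Set.mem_iUnion] at this ⊢
        obtain ⟨i, hi, h⟩ := this
        cases i with
        | zero => exact absurd (by simpa using h) hq
        | succ i => exact ⟨i, by omega, h⟩)
    obtain ⟨l, η, η', hl, hls, h7, h8, h9, h10⟩ := ih t (ν + ρ) (support_add_subset'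
      (fun q hq => Set.mem_biUnion (x := 0) (Nat.zero_le j) (by simpa using ht (h2 hq)))
      (h6.trans (Set.iUnion₂_mono fun i _ => by
        push_cast; rw [zero_add, add_mul, one_mul, add_comm]))) (ε / 2) hε2
    obtain ⟨ν'', h11, h12⟩ := exists_reach_phase hWc (k := l) (s' := -l) (s := 0) (by simp)
      (μ := ν') h3
    refine ⟨k + l, η, η' + ν'', by omega, ?_, ?_, h8, support_add_subset' (h9.trans ?_)
      (h12.trans ?_), ?_⟩
    · push_cast
      rw [hks, ← hls]
      ring
    · have h13 := h1.add h5
      rw [indicator_add_indicator_compl] at h13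
      have h14 := h7.add h11
      rw [show ν + ν' + ρ = ν + ρ + ν' by abel] at h13
      rw [← add_assoc]
      exact h13.trans h14
    · refine Set.iUnion_subset fun i => ?_
      refine (Set.subset_iUnion _ (i + 1)).trans' (le_of_eq (congrArg W ?_))
      push_cast
      rw [hks]
      ring
    · refine (Set.subset_iUnion _ 0).trans' (le_of_eq (congrArg W ?_))
      push_cast
      rw [hks]
      ring
    · simp only [Pi.add_apply, Finset.sum_add_distrib]
      rw [h11.sum_eq]
      calc _ ≤ ε / 2 + ε / 2 := add_le_add h10 h4
        _ = ε := add_halves ε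

/-- From a measure on the winning region, `S` is synchronized up to `ε`, and the whole resulting
measure is still on the winning region. -/
lemma exists_reach_allPhases [DecidableEq Q] [NeZero r]
    (hper : ∀ k, k₀ ≤ k → M.sure S (k + r) = M.sure S k)
    (hRW : ∀ s, M.sureClass S k₀ r s ⊆ W s)
    (hW : ∀ s, ∀ q ∈ W s, M.Hit W (M.sureClass S k₀ r) q s) {t : ZMod r} (ht : S ⊆ W t)
    {s : ZMod r} {μ : Q → ℝ≥0} (hμ : Function.support μ ⊆ allPhases W t s) {ε : ℝ≥0} (hε : ε ≠ 0) :
    ∃ (k : ℕ) (ν : Q → ℝ≥0), 1 ≤ k ∧ M.Reach k μ ν ∧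
      (∃ s', Function.support ν ⊆ allPhases W t s') ∧ outside S ν ≤ ε := by
  -- Since `r * t = 0`, indices `i ≤ r` cover all phases, and taking exactly `r` for `j` leaves the
  -- remainder at phase 0 modulo `t`, compatible with `S ⊆ W t`.
  obtain ⟨k, ν, ν', hk, hks, h1, h2, h3, h4⟩ := exists_reach_split_phases hper hRW hW ht r s μ
    (hμ.trans (Set.iUnion_subset fun i q hq => Set.mem_iUnion₂.2
      ⟨i % r, (Nat.mod_lt _ (NeZero.pos r)).le, by simpa using hq⟩)) ε hε
  have hs : s - k = 0 := by rw [← hks]; simp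
  refine ⟨k, ν + ν', hk, h1, ⟨_, support_add_subset' (h2.trans (ht.trans ?_)) h3⟩, ?_⟩
  · refine (Set.subset_iUnion _ 1).trans' (le_of_eq (congrArg W ?_))
    rw [hs]
    simp
  · rw [outside_add, outside_eq_zero h2, zero_add]
    exact (outside_le_sum _ _).trans h4

end Synchronize

end

/-! ### Chaining rounds into an infinite run -/

section

variable {Q A : Type*} [Fintype Q] [Fintype A] {M : MDP Q A}

/-- If, from every measure of a family, `T` can be synchronized up to any error while returning to
the family, then there is a sequence of steps along which `T` is synchronized infinitely often. -/
lemma exists_steps_of_recurrent {T : Set Q} {G : Set (Q → ℝ≥0)}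
    (hG : ∀ μ ∈ G, ∀ ε : ℝ≥0, ε ≠ 0 →
      ∃ (k : ℕ) (ν : Q → ℝ≥0), 1 ≤ k ∧ M.Reach k μ ν ∧ ν ∈ G ∧ outside T ν ≤ ε)
    {k₀ : ℕ} {μ μ₀ : Q → ℝ≥0} (hμ : M.Reach k₀ μ μ₀) (hμ₀ : μ₀ ∈ G) :
    ∃ d : ℕ → Q → ℝ≥0, d 0 = μ ∧ (∀ i, M.Step (d i) (d (i + 1))) ∧
      ∀ ε : ℝ≥0, ε ≠ 0 → {i | outside T (d i) ≤ ε}.Infinite := by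
  -- A state records the current measure, the steps left to the next target, and its rank.
  let P : (Q → ℝ≥0) × ℕ × ℕ → Prop := fun x =>
    ∃ ν ∈ G, M.Reach x.2.1 x.1 ν ∧ (x.2.2 = 0 ∨ outside T ν ≤ 1 / x.2.2)
  have hnext : ∀ x : {x // P x}, ∃ y : {x // P x}, M.Step x.1.1 y.1.1 ∧
      ((x.1.2.1 = y.1.2.1 + 1 ∧ y.1.2.2 = x.1.2.2) ∨
        (x.1.2.1 = 0 ∧ y.1.2.2 = x.1.2.2 + 1)) := by
    rintro ⟨⟨μ, k, j⟩, ν, hν, hr, hT⟩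
    cases k with
    | succ k =>
      obtain ⟨ρ, h1, h2⟩ := hr
      exact ⟨⟨⟨ρ, k, j⟩, ν, hν, h2, hT⟩, h1, Or.inl ⟨rfl, rfl⟩⟩
    | zero =>
      obtain rfl : μ = ν := hr
      obtain ⟨k, ν', hk, h1, h2, h3⟩ := hG μ hν (1 / (j + 1 : ℕ)) (by positivity)
      obtain ⟨k, rfl⟩ : ∃ l, k = l + 1 := ⟨k - 1, by omega⟩
      obtain ⟨ρ, h4, h5⟩ := h1
      exact ⟨⟨⟨ρ, k, j + 1⟩, ν', h2, h5, Or.inr h3⟩, h4, Or.inr ⟨rfl, rfl⟩⟩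
  choose next hstep hnext using hnext
  let X : ℕ → {x // P x} := fun i => next^[i] ⟨⟨μ, k₀, 0⟩, μ₀, hμ₀, hμ, Or.inl rfl⟩
  have hX : ∀ i, X (i + 1) = next (X i) := fun i => Function.iterate_succ_apply' _ _ _
  have hzero : ∀ k i, (X i).1.2.1 = k →
      ∃ i', i ≤ i' ∧ (X i').1.2.1 = 0 ∧ (X i').1.2.2 = (X i).1.2.2 := by
    intro k
    induction k with
    | zero => exact fun i hi => ⟨i, le_rfl, hi, rfl⟩
    | succ k ih =>
      intro i hi
      rcases hnext (X i) with ⟨h1, h2⟩ | ⟨h1, -⟩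
      · rw [← hX] at h1 h2
        obtain ⟨i', h3, h4, h5⟩ := ih (i + 1) (by omega)
        exact ⟨i', by omega, h4, h5.trans h2⟩
      · omega
  have hinf : ∀ N, ∃ i, N ≤ i ∧ (X i).1.2.1 = 0 ∧ N ≤ (X i).1.2.2 := by
    intro N
    induction N with
    | zero =>
      obtain ⟨i, h1, h2, -⟩ := hzero _ 0 rfl
      exact ⟨i, h1, h2, zero_le⟩
    | succ N ih =>
      obtain ⟨i, h1, h2, h3⟩ := ih
      rcases hnext (X i) with ⟨h4, -⟩ | ⟨-, h4⟩
      · omega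
      · rw [← hX] at h4
        obtain ⟨i', h5, h6, h7⟩ := hzero _ (i + 1) rfl
        exact ⟨i', by omega, h6, by omega⟩
  refine ⟨fun i => (X i).1.1, rfl, fun i => by
    simpa only [hX] using hstep (X i), fun ε hε => ?_⟩
  refine Set.infinite_of_not_bddAbove ?_
  rintro ⟨B, hB⟩
  obtain ⟨m, hm⟩ := exists_nat_one_div_lt (pos_iff_ne_zero.2 hε)
  obtain ⟨i, h1, h2, h3⟩ := hinf (max (B + 1) (m + 1))
  have hmem : outside T (X i).1.1 ≤ ε := by
    obtain ⟨ν, -, hr, hT⟩ := (X i).2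
    rw [h2] at hr
    have hr' : (X i).1.1 = ν := hr
    rw [hr']
    refine (hT.resolve_left (by omega)).trans (le_trans ?_ hm.le)
    refine one_div_le_one_div_of_le (by positivity) ?_
    exact_mod_cast (le_max_right (B + 1) (m + 1)).trans h3
  have := hB hmem
  omega

variable [DecidableEq Q]

lemma mass_eq_one_sub_outside {d : Q → ℝ≥0} (hd : ∑ q, d q = 1) (T : Finset Q) :
    mass (fun q => (d q : ℝ)) T = 1 - outside (T : Set Q) d := by
  have h1 : ∑ q ∈ T, d q + outside (T : Set Q) d = 1 := by
    rw [← hd, ← Finset.sum_add_sum_compl T, outside, Finset.sum_indicator_eq_sum_filter]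
    congr 1
    refine Finset.sum_congr (by ext; simp) fun _ _ => rfl
  rw [mass, eq_sub_iff_add_eq]
  exact_mod_cast h1

/-- An initial distribution as a measure. -/
noncomputable def distrMeasure (d₀ : Distr Q) (q : Q) : ℝ≥0 := ⟨d₀ q, d₀.2.1 q⟩

lemma sum_distrMeasure (d₀ : Distr Q) : ∑ q, distrMeasure d₀ q = 1 := by
  apply NNReal.coe_injective
  push_cast
  exact d₀.2.2

lemma outcomeMeasure_zero (M : MDP Q A) (d₀ : Distr Q) (σ : Strategy Q A) :
    M.outcomeMeasure d₀ σ 0 = distrMeasure d₀ :=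
  funext fun q => NNReal.coe_injective (outcome_zero M d₀ σ q)

lemma mem_almostSureWeakly_of_recurrent [Nonempty A] {T : Finset Q} {G : Set (Q → ℝ≥0)}
    (hG : ∀ μ ∈ G, ∀ ε : ℝ≥0, ε ≠ 0 →
      ∃ (k : ℕ) (ν : Q → ℝ≥0), 1 ≤ k ∧ M.Reach k μ ν ∧ ν ∈ G ∧ outside (T : Set Q) ν ≤ ε)
    {d₀ : Distr Q} {k₀ : ℕ} {μ₀ : Q → ℝ≥0} (hμ : M.Reach k₀ (distrMeasure d₀) μ₀)
    (hμ₀ : μ₀ ∈ G) : d₀ ∈ M.almostSureWeakly T := by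
  obtain ⟨d, h0, hd, hinf⟩ := exists_steps_of_recurrent hG hμ hμ₀
  obtain ⟨σ, hσ⟩ := exists_strategy M d₀ d (fun q => by rw [h0]; rfl) hd
  refine ⟨σ, fun ε hε => (hinf ⟨ε, hε.le⟩ (NNReal.coe_ne_zero.1 hε.ne')).mono ?_⟩
  intro i hi
  have hsum : ∑ q, d i q = 1 := by
    have := (Reach.of_steps hd 0 i).sum_eq
    rwa [h0, sum_distrMeasure, zero_add] at this
  have hi' : (outside (T : Set Q) (d i) : ℝ) ≤ ε := by exact_mod_cast hi
  change 1 - ε ≤ mass (M.outcome d₀ σ i) T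
  rw [show M.outcome d₀ σ i = fun q => (d i q : ℝ) from funext (hσ i),
    mass_eq_one_sub_outside hsum]
  linarith

end

/-! ### Pigeonhole on nearly synchronized positions -/

section

variable {Q A : Type*} [Fintype Q] [Fintype A] {M : MDP Q A}

lemma Reach.miss_lt {S : Set Q} {k : ℕ} {μ ν : Q → ℝ≥0} (h : M.Reach k μ ν) {q : Q} {θ c : ℝ≥0}
    (hθ : θ ≤ μ q) (hν : outside S ν < θ * c) : M.miss S k q < c := by
  refine lt_of_mul_lt_mul_left (a := θ) (lt_of_le_of_lt ?_ hν) zero_le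
  exact (mul_le_mul_left hθ _).trans ((Finset.single_le_sum (f := fun q => μ q * M.miss S k q)
    (fun _ _ => zero_le) (Finset.mem_univ q)).trans h.sum_mul_miss_le)

/-- If most of the mass lies in `T`, then most of it lies on the states of `T` with large mass. -/
lemma outside_large_lt [DecidableEq Q] [Nonempty Q] {T : Set Q} {d : Q → ℝ≥0} {θ : ℝ≥0}
    (hθ : θ ≠ 0) (hd : outside T d < θ) :
    outside {q | q ∈ T ∧ θ ≤ d q} d < Fintype.card Q * θ := by
  have hθ' : 0 < θ := pos_iff_ne_zero.2 hθ
  by_cases hT : ∀ q, q ∈ T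
  · have : (Fintype.card Q : ℝ≥0) * θ = ∑ _q : Q, θ := by simp
    rw [this]
    refine Finset.sum_lt_sum_of_nonempty Finset.univ_nonempty fun q _ => ?_
    by_cases h : θ ≤ d q
    · simpa [hT, h] using hθ'
    · simpa [hT, h] using lt_of_not_ge h
  -- A state `p ∉ T` is never a small state of `T`, so its share `θ` pays for the mass outside `T`.
  -- This gives the factor `n` instead of `n + 1`.
  · push Not at hT
    obtain ⟨p, hp⟩ := hT
    have hsum : (Fintype.card Q : ℝ≥0) * θ = θ + ∑ q, if q = p then 0 else θ := by
      rw [← Finset.sum_erase_add _ _ (Finset.mem_univ p), if_pos rfl, add_zero,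
        Finset.sum_congr rfl (g := fun _ => θ) fun q hq => if_neg (Finset.ne_of_mem_erase hq),
        add_comm, Finset.sum_erase_add Finset.univ (fun _ => θ) (Finset.mem_univ p)]
      simp
    rw [hsum]
    refine lt_of_le_of_lt ?_ (add_lt_add_left hd _)
    rw [outside, outside, ← Finset.sum_add_distrib]
    refine Finset.sum_le_sum fun q _ => ?_
    by_cases hq : q ∈ T
    · have hqp : q ≠ p := fun h => hp (h ▸ hq)
      by_cases h : θ ≤ d q
      · simp [hq, h]
      · simpa [hq, h, hqp] using (lt_of_not_ge h).le
    · simp [hq]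

variable [DecidableEq Q]

/-- If `S` can be reached from each of its states, and from each initial state, with sufficiently
large probability after a number of steps common to these states, then synchronization in `S` can
be repeated forever with arbitrarily small error. -/
lemma mem_almostSureWeakly_of_miss_lt [Nonempty A] [Nonempty Q] {α : ℝ≥0}
    (hα : ∀ q a q', M.tr q a q' ≠ 0 → α ≤ M.tr q a q') (hα0 : α ≠ 0) (hα1 : α ≤ 1)
    {T : Finset Q} {S : Set Q} (hST : S ⊆ T) {K : ℕ}
    (hK : (Fintype.card Q + 1) * 2 ^ Fintype.card Q ≤ K) {d₀ : Distr Q} {l k : ℕ} (hk : 1 ≤ k)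
    (hl : ∀ q, distrMeasure d₀ q ≠ 0 → M.miss S l q < α ^ K) (hS : ∀ q ∈ S, M.miss S k q < α ^ K) :
    d₀ ∈ M.almostSureWeakly T := by
  obtain ⟨k₀, r, hr, hkr, hper⟩ := exists_sure_periodic M S
  have : NeZero r := ⟨hr.ne'⟩
  obtain ⟨W, hRW, hW, hlose⟩ := exists_winning hα hα0 hα1 S hper
  have hkK : k₀ + Fintype.card Q * r ≤ K := by
    refine le_trans ?_ hK
    have h1 : Fintype.card Q * r ≤ Fintype.card Q * 2 ^ Fintype.card Q :=
      Nat.mul_le_mul_left _ (by omega)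
    rw [Nat.succ_mul]
    omega
  have key : ∀ (U : Set Q) (m : ℕ), (∀ q ∈ U, M.miss S m q < α ^ K) →
      U ⊆ M.sure S m ∨ U ⊆ W m := by
    intro U m hU
    rcases le_or_gt k₀ m with hm | hm
    · refine Or.inr fun q hq => ?_
      by_contra hqW
      exact absurd ((hlose _ q hqW m hm rfl).trans_lt (hU q hq))
        (not_lt.2 (pow_le_pow_of_le_one zero_le hα1 hkK))
    · refine Or.inl fun q hq => ?_
      by_contra hqs
      exact absurd ((pow_le_miss hα hqs).trans_lt (hU q hq))
        (not_lt.2 (pow_le_pow_of_le_one zero_le hα1 (by omega)))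
  obtain ⟨t, ht⟩ : ∃ t, S ⊆ W t := by
    -- If `k` is too short for the periodic regime, the sure return to `S` is iterated `k₀` times;
    -- `1 ≤ k` makes the total at least `k₀`.
    rcases key S k hS with h | h
    · refine ⟨((k₀ * k : ℕ) : ZMod r), (subset_sure_mul h k₀).trans ?_⟩
      rw [← sureClass_cast hper (Nat.le_mul_of_pos_right k₀ hk)]
      exact hRW _
    · exact ⟨_, h⟩
  have hsub : ∀ s, W s ⊆ allPhases W t s := fun s =>
    (Set.subset_iUnion _ 0).trans' (le_of_eq (congrArg W (by simp)))
  have hrec : ∀ μ ∈ {μ : Q → ℝ≥0 | ∃ s, Function.support μ ⊆ allPhases W t s}, ∀ ε : ℝ≥0, ε ≠ 0 →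
      ∃ (k : ℕ) (ν : Q → ℝ≥0), 1 ≤ k ∧ M.Reach k μ ν ∧
        ν ∈ {μ : Q → ℝ≥0 | ∃ s, Function.support μ ⊆ allPhases W t s} ∧
        outside (T : Set Q) ν ≤ ε := by
    rintro μ ⟨s, hs⟩ ε hε
    obtain ⟨k, ν, h1, h2, h3, h4⟩ := exists_reach_allPhases hper hRW hW ht hs hε
    exact ⟨k, ν, h1, h2, h3, (outside_anti hST ν).trans h4⟩
  rcases key (Function.support (distrMeasure d₀)) l hl with h | h
  · obtain ⟨ν, h1, h2⟩ := exists_reach_sure M S l _ h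
    exact mem_almostSureWeakly_of_recurrent hrec h1 ⟨t, h2.trans (ht.trans (hsub t))⟩
  · exact mem_almostSureWeakly_of_recurrent (k₀ := 0) hrec rfl ⟨_, h.trans (hsub _)⟩

/-- The left side is the exponent of `α` in the smallest threshold, `θ (2 ^ n + 1)`. -/
lemma exponent_le (n : ℕ) : (n + 1) * 2 ^ n * (2 ^ n + 1) ≤ (n + 2) * 4 ^ n := by
  have h1 : n + 1 ≤ 2 ^ n := Nat.lt_two_pow_self
  have h2 : 4 ^ n = 2 ^ n * 2 ^ n := by rw [← mul_pow]; norm_num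
  rw [h2]
  calc _ = (n + 1) * (2 ^ n * 2 ^ n) + (n + 1) * 2 ^ n := by ring
    _ ≤ (n + 1) * (2 ^ n * 2 ^ n) + 2 ^ n * 2 ^ n := by gcongr
    _ = _ := by ring

/-- A strategy that is nearly synchronized in `T` at more than `2 ^ n` positions yields almost-sure
weak synchronization. -/
lemma mem_almostSureWeakly_of_positions [Nonempty A] [Nonempty Q] {α α₀ : ℝ≥0}
    (hα : ∀ q a q', M.tr q a q' ≠ 0 → α ≤ M.tr q a q') (hα0 : α ≠ 0) (hα1 : α ≤ 1)
    {T : Finset Q} {d₀ : Distr Q} (hα₀ : ∀ q, distrMeasure d₀ q ≠ 0 → α₀ ≤ distrMeasure d₀ q)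
    (hα₀0 : α₀ ≠ 0) {n : ℕ} (hn : n = Fintype.card Q) {ε : ℝ≥0}
    (hε : ε = α₀ * (α ^ ((n + 2) * 4 ^ n) / (n : ℝ≥0) ^ (2 ^ n + 1)))
    {d : ℕ → Q → ℝ≥0} (hd0 : d 0 = distrMeasure d₀) (hd : ∀ i, M.Step (d i) (d (i + 1)))
    {e : Fin (2 ^ n + 1) → ℕ} (he : StrictMono e)
    (hout : ∀ m, outside (T : Set Q) (d (e m)) < ε) : d₀ ∈ M.almostSureWeakly T := by
  have hn1 : 1 ≤ n := hn ▸ Fintype.card_pos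
  have hn0 : (n : ℝ≥0) ≠ 0 := by positivity
  set K := (n + 1) * 2 ^ n with hK
  set b : ℝ≥0 := α ^ K / n with hb
  have hb0 : b ≠ 0 := div_ne_zero (pow_ne_zero _ hα0) hn0
  have hnb : n * b = α ^ K := mul_div_cancel₀ _ hn0
  have hb1 : b ≤ 1 := by
    refine div_le_one_of_le₀ ((pow_le_one₀ zero_le hα1).trans ?_) zero_le
    exact_mod_cast hn1
  let θ : ℕ → ℝ≥0 := fun m => α₀ * b ^ m
  have hθ0 : ∀ m, θ m ≠ 0 := fun m => mul_ne_zero hα₀0 (pow_ne_zero _ hb0)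
  have hθ : ∀ m m', m ≤ m' → θ m' ≤ θ m := fun m m' h =>
    mul_le_mul_right (pow_le_pow_of_le_one zero_le hb1 h) _
  have hεθ : ∀ m, m ≤ 2 ^ n + 1 → ε ≤ θ m := by
    intro m hm
    refine le_trans ?_ (hθ m _ hm)
    rw [hε]
    refine mul_le_mul_right ?_ _
    rw [hb, div_pow, ← pow_mul]
    exact div_le_div_of_nonneg_right (pow_le_pow_of_le_one zero_le hα1 (exponent_le n)) zero_le
  let S : Fin (2 ^ n + 1) → Set Q := fun m => {q | q ∈ (T : Set Q) ∧ θ (m + 1) ≤ d (e m) q}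
  have hS : ∀ m : Fin (2 ^ n + 1), outside (S m) (d (e m)) < θ m * α ^ K := by
    intro m
    refine (outside_large_lt (hθ0 (m + 1)) ((hout m).trans_le (hεθ _ (by omega)))).trans_eq ?_
    rw [← hnb]
    simp only [θ, pow_succ, ← hn]
    ring
  obtain ⟨i, j, hij, h⟩ := Fintype.exists_ne_map_eq_of_card_lt S (by simp [hn])
  wlog hlt : i < j generalizing i j
  · exact this j i hij.symm h.symm (lt_of_le_of_ne (not_lt.1 hlt) hij.symm)
  have hlt' : e i < e j := he hlt
  have hi : M.Reach (e i) (distrMeasure d₀) (d (e i)) := by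
    simpa [hd0] using Reach.of_steps hd 0 (e i)
  have hj : M.Reach (e j - e i) (d (e i)) (d (e j)) := by
    have := Reach.of_steps hd (e i) (e j - e i)
    rwa [Nat.add_sub_of_le hlt'.le] at this
  refine mem_almostSureWeakly_of_miss_lt hα hα0 hα1 (S := S i) (fun q hq => hq.1) (K := K) (by rw [← hn])
    (l := e i) (k := e j - e i) (by omega) (fun q hq => ?_) (fun q hq => ?_)
  · refine hi.miss_lt (hα₀ q hq) ((hS i).trans_le (mul_le_mul_left ?_ _))
    exact (hθ 0 i (Nat.zero_le _)).trans (by simp [θ])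
  · refine hj.miss_lt hq.2 ?_
    rw [h]
    -- The shift in `S`, with threshold `θ (m + 1)` but error `θ m * α ^ K`, matters here: `i < j`
    -- gives `θ j ≤ θ (i + 1)`.
    exact (hS j).trans_le (mul_le_mul_left (hθ _ _ hlt) _)

end

end MDP

theorem theorem2 {Q A : Type*} [Fintype Q] [DecidableEq Q] [Fintype A]
    (M : MDP Q A) (T : Finset Q) (d₀ : Distr Q)
    (n : ℕ) (hn : n = Fintype.card Q)
    (α : ℝ) (hα : IsLeast M.positiveProbs α)
    (α₀ : ℝ) (hα₀ : IsLeast {p : ℝ | 0 < p ∧ ∃ q, d₀ q = p} α₀)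
    (εw : ℝ) (hεw : εw = α₀ * (α ^ ((n + 2) * 4 ^ n) / (n : ℝ) ^ (2 ^ n + 1)))
    (Nw : ℕ) (hNw : Nw = 2 ^ n)
    (hd₀ : d₀ ∉ M.almostSureWeakly T) (σ : Strategy Q A) :
    {i : ℕ | IsStrictlySynchronized (1 - εw) (M.outcome d₀ σ i) T}.encard ≤ (Nw : ℕ∞) := by
  by_contra hcard
  refine hd₀ ?_
  obtain ⟨⟨hαpos, q, a, q', hαeq⟩, hαle⟩ := hα
  obtain ⟨⟨hα₀pos, -⟩, hα₀le⟩ := hα₀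
  have : Nonempty A := ⟨a⟩
  have : Nonempty Q := ⟨q⟩
  subst hn hNw
  have hle : ((2 ^ Fintype.card Q + 1 : ℕ) : ℕ∞) ≤
      {i : ℕ | IsStrictlySynchronized (1 - εw) (M.outcome d₀ σ i) T}.encard := by
    push_cast
    exact Order.add_one_le_of_lt (by simpa using lt_of_not_ge hcard)
  obtain ⟨t, htsub, ht⟩ := Set.exists_subset_encard_eq hle
  have htfin : t.Finite := Set.finite_of_encard_eq_coe ht
  have htcard : htfin.toFinset.card = 2 ^ Fintype.card Q + 1 := by
    rw [htfin.encard_eq_coe_toFinset_card] at ht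
    exact_mod_cast ht
  have hpos : ∀ x : ℝ≥0, x ≠ 0 → (0 : ℝ) < x := fun x hx => by exact_mod_cast pos_iff_ne_zero.2 hx
  refine MDP.mem_almostSureWeakly_of_positions (M := M) (α := ⟨α, hαpos.le⟩) (α₀ := ⟨α₀, hα₀pos.le⟩)
    (ε := ⟨εw, by rw [hεw]; positivity⟩) (d := M.outcomeMeasure d₀ σ)
    (e := htfin.toFinset.orderEmbOfFin htcard)
    (fun q a q' h => hαle ⟨hpos _ h, q, a, q', rfl⟩) (NNReal.coe_ne_zero.1 hαpos.ne') ?_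
    (fun q h => hα₀le ⟨hpos _ h, q, rfl⟩) (NNReal.coe_ne_zero.1 hα₀pos.ne')
    rfl (NNReal.coe_injective hεw)
    (MDP.outcomeMeasure_zero M d₀ σ) (MDP.step_outcomeMeasure M d₀ σ)
    (OrderEmbedding.strictMono _) fun m => ?_
  · have h1 : M.tr q a q' ≤ 1 := by
      rw [← MDP.sum_tr M q a]
      exact Finset.single_le_sum (fun _ _ => zero_le) (Finset.mem_univ q')
    have h2 : (M.tr q a q' : ℝ) ≤ 1 := by exact_mod_cast h1
    exact hαeq ▸ h2
  · set i := htfin.toFinset.orderEmbOfFin htcard m with hi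
    have hmem : i ∈ t := htfin.mem_toFinset.1 (Finset.orderEmbOfFin_mem _ htcard m)
    have h1 : 1 - εw < mass (M.outcome d₀ σ i) T := htsub hmem
    have hsum : ∑ q, M.outcomeMeasure d₀ σ i q = 1 := by
      have := (MDP.Reach.of_steps (MDP.step_outcomeMeasure M d₀ σ) 0 i).sum_eq
      rwa [MDP.outcomeMeasure_zero, MDP.sum_distrMeasure, zero_add] at this
    have h2 := MDP.mass_eq_one_sub_outside hsum T
    rw [show (fun q => (M.outcomeMeasure d₀ σ i q : ℝ)) = M.outcome d₀ σ i from rfl] at h2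
    have h3 : (MDP.outside (T : Set Q) (M.outcomeMeasure d₀ σ i) : ℝ) < εw := by linarith
    exact h3
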